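/- Call a finite group $G$ \emph{evolving} if for every prime $p$ and every $p$-subgroup $I\le G$ there is a subgroup $J$ with $I\le J\le G$ such that $|G:J|$ is a power of $p$ and $p\nmid |J:I|$. An automorphism of a group is \emph{intense} if it maps every subgroup to a conjugate; $\mathrm{Int}(H)$ denotes the group of intense automorphisms of $H$. Let $\pi$ be the set of primes dividing $|G|$. A \emph{Sylow family} of $G$ is a family $(S_p)_{p\in\pi}$, with $S_p$ a Sylow $p$-subgroup of $G$, such that $S_q$ normalizes $S_p$ whenever $p,q\in\pi$ and $q<p$. For $p\in\pi$ put $T_p=\langle S_q : q\in\pi,\ q<p\rangle$, which acts on $S_p$ by conjugation. \textbf{Theorem.} Let $G$ be an evolving group and let $(S_p)_{p\in\pi}$ be a Sylow family of $G$. For every $p\in\pi$ the image of $T_p\to\mathrm{Aut}(S_p)$ is contained in $\mathrm{Int}(S_p)$. Hence one can define $\lambda_p\colon T_p\to\mathbb F_p^*$ as the composition $$T_p\to \mathrm{Int}(S_p)\to\mathrm{Int}(S_p/\Phi(S_p))\to\mathbb F_p^*,$$ where $\Phi(S_p)$ is the Frattini subgroup and the last map sends an intense automorphism of the nonzero $\mathbb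 F_p$-vector space $S_p/\Phi(S_p)$ to the unique scalar by which it acts. Let $\Gamma$ be the directed graph with vertex set $\pi$ and edge set $E=\{(q,p)\in\pi^2 : q<p,\ \lambda_p(S_q)\ne 1\}$, let $\pi_s=\{q : (q,p)\in E \text{ for some } p\}$ be the set of sources and $\pi_t=\{p : (q,p)\in E\text{ for some } q\}$ the set of targets of edges, and put $\pi_0=\pi\setminus(\pi_s\cup\pi_t)$. Then $\Gamma$ does not depend on the choice of the Sylow family, $\pi_s\cap\pi_t=\emptyset$ (that is, $\Gamma$ has no consecutive edges), and $$G=\Bigl(\prod_{p\in\pi_t}S_p\rtimes\prod_{p\in\pi_s}S_p\Bigr)\times\prod_{p\in\pi_0}S_p,$$ where $\prod_{p\in\pi_*}S_p$ denotes the internal direct product of the $S_p$ with $p\in\pi_*$ as a subgroup of $G$, and $\rtimes$ and $\times$ denote internal semidirect and direct products. -/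

import Mathlib

namespace Evolving

/-- A group is *evolving* if it is finite and, for every prime `p`, every `p`-subgroup `I` is
contained in a subgroup `J` whose index is a power of `p` and for which `p` does not
divide `|J : I|`. -/
def IsEvolving (G : Type*) [Group G] : Prop :=
  Finite G ∧ ∀ p : ℕ, p.Prime → ∀ I : Subgroup G, IsPGroup p I →
    ∃ J : Subgroup G, I ≤ J ∧ (∃ k : ℕ, J.index = p ^ k) ∧ ¬ p ∣ I.relIndex J

/-! ### Intense automorphisms -/

section Intense

variable {G : Type*} [Group G]

/-- `Int(G)`: the automorphisms of `G` that map every subgroup to a conjugate. -/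
def IntenseAut (G : Type*) [Group G] : Subgroup (MulAut G) where
  carrier := {α | ∀ H : Subgroup G, ∃ x : G,
    H.map α.toMonoidHom = H.map (MulAut.conj x).toMonoidHom}
  one_mem' := fun H => ⟨1, by rw [map_one]⟩
  mul_mem' := by
    intro α β hα hβ H
    obtain ⟨x, hx⟩ := hβ H
    obtain ⟨y, hy⟩ := hα (H.map (MulAut.conj x).toMonoidHom)
    refine ⟨y * x, ?_⟩
    have h1 : (α * β).toMonoidHom = α.toMonoidHom.comp β.toMonoidHom := rfl
    have h2 : (MulAut.conj (y * x)).toMonoidHom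
        = (MulAut.conj y).toMonoidHom.comp (MulAut.conj x).toMonoidHom := by
      rw [map_mul]; rfl
    rw [h1, h2, ← Subgroup.map_map, ← Subgroup.map_map, hx, hy]
  inv_mem' := by
    intro α hα H
    obtain ⟨x, hx⟩ := hα (H.map (α⁻¹).toMonoidHom)
    refine ⟨x⁻¹, ?_⟩
    have h1 : α.toMonoidHom.comp (α⁻¹).toMonoidHom = MonoidHom.id G := by
      ext g; exact α.apply_symm_apply g
    have h2 : (MulAut.conj x⁻¹).toMonoidHom.comp (MulAut.conj x).toMonoidHom
        = MonoidHom.id G := by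
      ext g; simp [mul_assoc]
    rw [Subgroup.map_map, h1, Subgroup.map_id] at hx
    conv_rhs => rw [hx]
    rw [Subgroup.map_map, h2, Subgroup.map_id]

theorem map_eq_of_mem_intenseAut {α : MulAut G} (hα : α ∈ IntenseAut G) (N : Subgroup G) [hN : N.Normal] :
    N.map α.toMonoidHom = N := by
  obtain ⟨x, hx⟩ := hα N
  rw [hx]
  ext g
  constructor
  · rintro ⟨n, hn, rfl⟩
    exact hN.conj_mem n hn x
  · intro hg
    refine ⟨x⁻¹ * g * x, by simpa using hN.conj_mem g hg x⁻¹, ?_⟩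
    change x * (x⁻¹ * g * x) * x⁻¹ = g
    group

/-- For a normal subgroup `N` of `G`, the homomorphism `Int(G) → Int(G/N)` induced by
the projection `G → G/N`. -/
def intQuotient (N : Subgroup G) [N.Normal] : IntenseAut G →* IntenseAut (G ⧸ N) where
  toFun α := ⟨QuotientGroup.congr N N α.1 (map_eq_of_mem_intenseAut α.2 N), by
    intro H
    obtain ⟨x, hx⟩ := α.2 (H.comap (QuotientGroup.mk' N))
    refine ⟨QuotientGroup.mk' N x, ?_⟩
    have h := congrArg (Subgroup.map (QuotientGroup.mk' N)) hx
    rw [Subgroup.map_map, Subgroup.map_map] at h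
    have h1 : (QuotientGroup.mk' N).comp α.1.toMonoidHom
        = (QuotientGroup.congr N N α.1 (map_eq_of_mem_intenseAut α.2 N)).toMonoidHom.comp
          (QuotientGroup.mk' N) := by ext g; rfl
    have h2 : (QuotientGroup.mk' N).comp (MulAut.conj x).toMonoidHom
        = (MulAut.conj (QuotientGroup.mk' N x)).toMonoidHom.comp
          (QuotientGroup.mk' N) := by ext g; rfl
    rw [h1, h2, ← Subgroup.map_map, ← Subgroup.map_map,
      Subgroup.map_comap_eq_self_of_surjective (QuotientGroup.mk'_surjective N)] at h
    exact h⟩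
  map_one' := by
    apply Subtype.ext; apply MulEquiv.ext; intro v
    obtain ⟨g, rfl⟩ := QuotientGroup.mk'_surjective N v
    rfl
  map_mul' α β := by
    apply Subtype.ext; apply MulEquiv.ext; intro v
    obtain ⟨g, rfl⟩ := QuotientGroup.mk'_surjective N v
    rfl

end Intense

/-! ### Intense automorphisms of a vector space over `𝔽_p` -/

section Scalar

/-- `V` is (the additive group, written multiplicatively, of) a nonzero vector space over
the field of `p` elements. -/
structure IsVectorSpaceOver (p : ℕ) (V : Type*) [Group V] : Prop where
  comm : ∀ v w : V, v * w = w * v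
  pow_eq_one : ∀ v : V, v ^ p = 1
  nontrivial : Nontrivial V

variable {p : ℕ} [hp : Fact p.Prime] {V : Type*} [Group V]

theorem IsVectorSpaceOver.zpow_eq_one_iff (hV : IsVectorSpaceOver p V) {v : V} (hv : v ≠ 1)
    (k : ℤ) : v ^ k = 1 ↔ (k : ZMod p) = 0 := by
  rw [← orderOf_dvd_iff_zpow_eq_one, orderOf_eq_prime (hV.pow_eq_one v) hv,
    ZMod.intCast_zmod_eq_zero_iff_dvd]

theorem IsVectorSpaceOver.pow_val_eq_zpow (hV : IsVectorSpaceOver p V) (v : V) (k : ℤ) :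
    v ^ (k : ZMod p).val = v ^ k := by
  by_cases hv : v = 1
  · simp [hv]
  · have h : v ^ (((k : ZMod p).val : ℤ) - k) = 1 := by
      rw [hV.zpow_eq_one_iff hv]; simp
    rw [zpow_sub, mul_inv_eq_one, zpow_natCast] at h
    exact h

theorem IsVectorSpaceOver.exists_scalar (hV : IsVectorSpaceOver p V) {α : MulAut V}
    (hα : α ∈ IntenseAut V) : ∃ μ : ZMod p, ∀ v : V, α v = v ^ μ.val := by
  have key : ∀ v : V, ∃ k : ℤ, α v = v ^ k := by
    intro v
    obtain ⟨x, hx⟩ := hα (Subgroup.zpowers v)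
    have hmem : α v ∈ (Subgroup.zpowers v).map α.toMonoidHom :=
      ⟨v, Subgroup.mem_zpowers v, rfl⟩
    rw [hx] at hmem
    obtain ⟨w, hw, hw'⟩ := hmem
    obtain ⟨k, rfl⟩ := hw
    refine ⟨k, ?_⟩
    rw [← hw']
    change x * v ^ k * x⁻¹ = v ^ k
    rw [hV.comm x, mul_inv_cancel_right]
  have := hV.nontrivial
  obtain ⟨u, hu⟩ := exists_ne (1 : V)
  obtain ⟨b, hb⟩ := key u
  refine ⟨(b : ZMod p), fun v => ?_⟩
  rw [hV.pow_val_eq_zpow]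
  by_cases hvu : v ∈ Subgroup.zpowers u
  · obtain ⟨n, rfl⟩ := hvu
    change α (u ^ n) = (u ^ n) ^ b
    rw [map_zpow, hb, ← zpow_mul, ← zpow_mul, mul_comm]
  · have hv1 : v ≠ 1 := fun h => hvu (h ▸ Subgroup.one_mem _)
    obtain ⟨a, ha⟩ := key v
    obtain ⟨c, hc⟩ := key (v * u)
    have hcomm : Commute v u := hV.comm v u
    rw [map_mul, ha, hb, hcomm.mul_zpow] at hc
    have h1 : v ^ (a - c) = u ^ (c - b) := by
      rw [← eq_mul_inv_iff_mul_eq] at hc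
      rw [zpow_sub, zpow_sub, mul_inv_eq_iff_eq_mul, hc, hV.comm _ (v ^ c), mul_assoc]
    have h2 : ((a - c : ℤ) : ZMod p) = 0 := by
      by_contra hne
      apply hvu
      have hi : ((a - c : ℤ) : ZMod p) * ((a - c : ℤ) : ZMod p)⁻¹ = 1 := mul_inv_cancel₀ hne
      obtain ⟨m, hm⟩ := ZMod.intCast_surjective (((a - c : ℤ) : ZMod p)⁻¹)
      have h3 : v ^ ((a - c) * m - 1) = 1 := by
        rw [hV.zpow_eq_one_iff hv1]; push_cast at hi ⊢; rw [hm]; push_cast; rw [hi, sub_self]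
      rw [zpow_sub, mul_inv_eq_one, zpow_one, zpow_mul, h1] at h3
      rw [← h3]
      exact Subgroup.zpow_mem _ (Subgroup.zpow_mem _ (Subgroup.mem_zpowers u) _) _
    have h3 : v ^ (a - c) = 1 := (hV.zpow_eq_one_iff hv1 _).2 h2
    have h4 : ((c - b : ℤ) : ZMod p) = 0 := (hV.zpow_eq_one_iff hu _).1 (h1 ▸ h3)
    have h5 : v ^ (a - b) = 1 := by
      rw [hV.zpow_eq_one_iff hv1]
      push_cast at h2 h4 ⊢
      rw [← sub_add_sub_cancel (a : ZMod p) c b, h2, h4, add_zero]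
    rw [zpow_sub, mul_inv_eq_one] at h5
    rw [ha, h5]

theorem IsVectorSpaceOver.scalar_unique (hV : IsVectorSpaceOver p V) {μ ν : ZMod p}
    (h : ∀ v : V, v ^ μ.val = v ^ ν.val) : μ = ν := by
  have := hV.nontrivial
  obtain ⟨u, hu⟩ := exists_ne (1 : V)
  have h1 := h u
  have h2 : u ^ ((μ.val : ℤ) - ν.val) = 1 := by
    rw [zpow_sub, mul_inv_eq_one, zpow_natCast, zpow_natCast, h1]
  rw [hV.zpow_eq_one_iff hu] at h2
  simpa [sub_eq_zero] using h2

/-- The homomorphism `Int(V) → 𝔽_p^*` for a nonzero `𝔽_p`-vector space `V`: an intense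
automorphism `α` is sent to the unique scalar `μ` with `α v = μ v` for all `v`
(`v ^ μ` in multiplicative notation). -/
noncomputable def intScalar (hV : IsVectorSpaceOver p V) : IntenseAut V →* (ZMod p)ˣ :=
  MonoidHom.toHomUnits
    { toFun := fun α => (hV.exists_scalar α.2).choose
      map_one' := by
        apply hV.scalar_unique
        intro v
        rw [← (hV.exists_scalar (1 : IntenseAut V).2).choose_spec v, ZMod.val_one, pow_one]
        rfl
      map_mul' := by
        intro α β
        apply hV.scalar_unique
        intro v
        have h := fun γ : IntenseAut V => (hV.exists_scalar γ.2).choose_spec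
        rw [← h (α * β) v]
        change α.1 (β.1 v) = _
        rw [h β v, h α, ← pow_mul, mul_comm, ZMod.val_mul]
        exact pow_eq_pow_mod _ (hV.pow_eq_one v) |>.trans (by rw [mul_comm]) }

theorem intScalar_spec (hV : IsVectorSpaceOver p V) (α : IntenseAut V) (v : V) :
    α.1 v = v ^ ((intScalar hV α : (ZMod p)ˣ) : ZMod p).val :=
  (hV.exists_scalar α.2).choose_spec v

theorem isVectorSpaceOver_quotient_frattini {P : Type*} [Group P] [Finite P] [Nontrivial P]
    (hP : IsPGroup p P) : IsVectorSpaceOver p (P ⧸ frattini P) := by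
  have hnil : Group.IsNilpotent P := hP.isNilpotent
  have hM : ∀ M : Subgroup P, IsCoatom M → M.Normal ∧ M.index = p := by
    intro M hM
    refine ⟨Subgroup.NormalizerCondition.normal_of_coatom M
      Group.normalizerCondition_of_isNilpotent hM, ?_⟩
    obtain ⟨n, hn⟩ := IsPGroup.iff_card.1 hP
    obtain ⟨m, hm⟩ := IsPGroup.iff_card.1 (hP.to_subgroup M)
    have hlt : m < n := by
      rw [← Nat.pow_lt_pow_iff_right hp.out.one_lt, ← hn, ← hm]
      refine lt_of_le_of_ne (Subgroup.card_le_card_group M) fun h => hM.1 ?_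
      exact Subgroup.eq_top_of_card_eq M h
    have hdvd : p ^ (m + 1) ∣ Nat.card P := by rw [hn]; exact pow_dvd_pow p hlt
    obtain ⟨K, hK, hMK⟩ := Sylow.exists_subgroup_card_pow_succ hdvd hm
    have hKt : K = ⊤ := by
      apply hM.2 K
      refine lt_of_le_of_ne hMK ?_
      rintro rfl
      rw [hm] at hK
      exact absurd (Nat.pow_right_injective hp.out.two_le hK) (by omega)
    have hcard : Nat.card P = p ^ (m + 1) := by
      rw [← hK, hKt, Subgroup.card_top]
    have hmul := M.card_mul_index
    rw [hm, hcard, pow_succ] at hmul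
    exact Nat.eq_of_mul_eq_mul_left (pow_pos hp.out.pos m) hmul
  have hfr : ∀ g : P, (∀ M : Subgroup P, IsCoatom M → g ∈ M) → g ∈ frattini P := by
    intro g hg
    rw [frattini, Order.radical]
    simp only [Subgroup.mem_iInf]
    exact fun M hM => hg M hM
  refine ⟨?_, ?_, ?_⟩
  · intro v w
    obtain ⟨a, rfl⟩ := QuotientGroup.mk'_surjective _ v
    obtain ⟨b, rfl⟩ := QuotientGroup.mk'_surjective _ w
    rw [← map_mul, ← map_mul]
    refine QuotientGroup.eq.2 (hfr _ fun M hMc => ?_)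
    obtain ⟨hMn, hMi⟩ := hM M hMc
    rw [Subgroup.index_eq_card] at hMi
    have : IsCyclic (P ⧸ M) := isCyclic_of_prime_card hMi
    have hcm : ∀ x y : P ⧸ M, x * y = y * x := fun x y => by
      let _ := IsCyclic.commGroup (α := P ⧸ M)
      exact mul_comm x y
    exact QuotientGroup.eq.1 (hcm (QuotientGroup.mk' M a) (QuotientGroup.mk' M b))
  · intro v
    obtain ⟨a, rfl⟩ := QuotientGroup.mk'_surjective _ v
    rw [← map_pow]
    refine (QuotientGroup.eq_one_iff _).2 (hfr _ fun M hMc => ?_)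
    obtain ⟨hMn, hMi⟩ := hM M hMc
    rw [Subgroup.index_eq_card] at hMi
    rw [← QuotientGroup.eq_one_iff, QuotientGroup.mk_pow, ← hMi]
    exact pow_card_eq_one'
  · rw [QuotientGroup.nontrivial_iff]
    obtain ⟨M, hMc, -⟩ := (eq_top_or_exists_le_coatom (⊥ : Subgroup P)).resolve_left bot_ne_top
    exact fun h => hMc.1 (top_le_iff.1 (h ▸ frattini_le_coatom hMc))

end Scalar

/-! ### Sylow families, the characters `λ_p` and the graph -/

/-- `π`: the set of prime divisors of `|G|`. -/
abbrev PrimeDivisor (G : Type*) [Group G] : Type := {p : ℕ // p.Prime ∧ p ∣ Nat.card G}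

instance {G : Type*} [Group G] (p : PrimeDivisor G) : Fact (p : ℕ).Prime := ⟨p.2.1⟩

/-- A *Sylow family* of `G`: a Sylow `p`-subgroup `S_p` for each prime divisor `p` of `|G|`, such
that `S_q` normalizes `S_p` whenever `q < p`. -/
structure SylowFamily (G : Type*) [Group G] where
  sylow : ∀ p : PrimeDivisor G, Sylow p G
  normalizes : ∀ p q : PrimeDivisor G, q < p →
    (sylow q : Subgroup G) ≤ Subgroup.normalizer (sylow p : Set G)

namespace SylowFamily

variable {G : Type*} [Group G] (S : SylowFamily G)

/-- The subgroup `S_p`. -/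
def grp (p : PrimeDivisor G) : Subgroup G := (S.sylow p : Subgroup G)

/-- The subgroup `T_p` generated by the `S_q` with `q < p`. -/
def T (p : PrimeDivisor G) : Subgroup G := ⨆ q : {q : PrimeDivisor G // q < p}, S.grp q

theorem T_le_normalizer (p : PrimeDivisor G) :
    S.T p ≤ Subgroup.normalizer (S.grp p : Set G) :=
  iSup_le fun q => S.normalizes p q q.2

/-- The action `T_p → Aut(S_p)` by conjugation. -/
def act (p : PrimeDivisor G) : S.T p →* MulAut (S.grp p) :=
  (S.grp p).normalizerMonoidHom.comp (Subgroup.inclusion (S.T_le_normalizer p))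

/-- For every `p`, the image of `T_p → Aut(S_p)` is contained in `Int(S_p)`. -/
def ActsIntensely : Prop := ∀ p : PrimeDivisor G, ∀ x : S.T p, S.act p x ∈ IntenseAut (S.grp p)

theorem nontrivial_grp [Finite G] (p : PrimeDivisor G) : Nontrivial (S.grp p) :=
  (Subgroup.nontrivial_iff_ne_bot _).2 ((S.sylow p).ne_bot_of_dvd_card p.2.2)

theorem isVectorSpaceOver [Finite G] (p : PrimeDivisor G) :
    IsVectorSpaceOver (p : ℕ) (S.grp p ⧸ frattini (S.grp p)) :=
  haveI := S.nontrivial_grp p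
  isVectorSpaceOver_quotient_frattini (S.sylow p).isPGroup'

/-- `λ_p`, the composition `T_p → Int(S_p) → Int(S_p/Φ(S_p)) → 𝔽_p^*`. -/
noncomputable def lam [Finite G] (hS : S.ActsIntensely) (p : PrimeDivisor G) :
    S.T p →* (ZMod p)ˣ :=
  (intScalar (S.isVectorSpaceOver p)).comp
    ((intQuotient (frattini (S.grp p))).comp ((S.act p).codRestrict (IntenseAut (S.grp p)) (hS p)))

/-- The directed graph on the prime divisors of `|G|` with an edge from `q` to `p` precisely if
`q < p` and `λ_p(S_q) ≠ 1`. -/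
def graph [Finite G] (hS : S.ActsIntensely) : Digraph (PrimeDivisor G) where
  Adj q p := q < p ∧ ((S.grp q).subgroupOf (S.T p)).map (S.lam hS p) ≠ ⊥

end SylowFamily

section Graph

variable {V : Type*} (Γ : Digraph V)

/-- The set `π_s` of sources of edges. -/
def sources : Set V := {q | ∃ p, Γ.Adj q p}

/-- The set `π_t` of targets of edges. -/
def targets : Set V := {p | ∃ q, Γ.Adj q p}

/-- The set `π_0` of the vertices that lie on no edge. -/
def isolated : Set V := (sources Γ ∪ targets Γ)ᶜ

end Graph

/-! ### Internal products -/

section Internal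

variable {G : Type*} [Group G]

/-- `K` is the internal direct product of the family `H`. -/
def IsInternalProd {ι : Type*} (H : ι → Subgroup G) (K : Subgroup G) : Prop :=
  (∀ i j, i ≠ j → ∀ x ∈ H i, ∀ y ∈ H j, x * y = y * x) ∧ iSupIndep H ∧ ⨆ i, H i = K

/-- `K` is the internal semidirect product `N ⋊ T`, where `T` acts on `N` by conjugation. -/
def IsInternalSemidirect (N T K : Subgroup G) : Prop :=
  T ≤ Subgroup.normalizer (N : Set G) ∧ N ⊓ T = ⊥ ∧ N ⊔ T = K

/-- `K` is the internal direct product `A × B`. -/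
def IsInternalDirect (A B K : Subgroup G) : Prop :=
  (∀ x ∈ A, ∀ y ∈ B, x * y = y * x) ∧ A ⊓ B = ⊥ ∧ A ⊔ B = K

end Internal

end Evolving

/-! Let A and N be generated by the `S_r` with r ≥ p and with r > p. Both are normal in G, A = N S_p
and N ∩ S_p = 1. For I ≤ S_p, the subgroup J supplied by evolvingness satisfies AJ = G, and A ∩ J
has the same image as I modulo N. Writing x ∈ T_p as n s j, with n ∈ N, s ∈ S_p and j ∈ J, shows
that x sends I to its conjugate by s, so T_p acts intensely (`exists_conj_eq_of_mem_T`).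

Coprime action turns λ_p(S_q) = 1 into commutation of S_q with S_p (`graph_adj_iff`). This can be
read in A/N, and A, N do not depend on the family, so neither does the graph (`graph_eq_graph`).

If q → p, some x ∈ S_q acts on S_p/Φ(S_p) as a scalar μ ≠ 1. The commutators [x, y] then generate
S_p modulo Φ(S_p), and λ_r kills them because its target is abelian. So no edge leaves p
(`not_adj_of_adj`). The decomposition follows, since Sylow subgroups not joined by an edge commute.
-/

namespace Evolving

/-! ### Coprime action and scalars modulo the Frattini subgroup -/

section Coprime

variable {G : Type*} [Group G]

theorem card_sup_dvd_of_le_normalizer {H K : Subgroup G}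
    (h : H ≤ Subgroup.normalizer (K : Set G)) :
    Nat.card (H ⊔ K : Subgroup G) ∣ Nat.card H * Nat.card K := by
  have hK : K ≤ Subgroup.normalizer (K : Set G) := Subgroup.le_normalizer
  -- The index formula needs `K` normal, hence the passage to its normalizer.
  have h1 := Subgroup.relIndex_sup_right (H.subgroupOf (Subgroup.normalizer (K : Set G)))
    (K.subgroupOf (Subgroup.normalizer (K : Set G)))
  rw [← Subgroup.subgroupOf_sup h hK, Subgroup.relIndex_subgroupOf (sup_le h hK),
    Subgroup.relIndex_subgroupOf h] at h1
  have h2 := Subgroup.relIndex_mul_relIndex ⊥ K (H ⊔ K) bot_le le_sup_right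
  rw [Subgroup.relIndex_bot_left, Subgroup.relIndex_bot_left, h1] at h2
  rw [← h2, mul_comm]
  exact Nat.mul_dvd_mul (Subgroup.relIndex_dvd_card _ _) dvd_rfl

/-- A `q`-group of automorphisms of a finite `p`-group, `q ≠ p`, that acts trivially modulo
the Frattini subgroup is trivial. -/
theorem eq_of_trivial_mod_frattini {p q : ℕ} [hp : Fact p.Prime] [hq : Fact q.Prime] (hpq : q ≠ p)
    {P Q : Type*} [Group P] [Finite P] [Group Q] [Finite Q] (hP : IsPGroup p P)
    (hQ : IsPGroup q Q) (f : Q →* MulAut P) (hf : ∀ x v, v⁻¹ * f x v ∈ frattini P) (x : Q) (v : P) :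
    f x v = v := by
  let C : Subgroup P :=
    { carrier := {w | ∀ x, f x w = w}
      one_mem' := fun x => map_one _
      mul_mem' := fun {a b} ha hb x => by rw [map_mul, ha, hb]
      inv_mem' := fun {a} ha x => by rw [map_inv, ha] }
  suffices h : C = ⊤ by
    have hv : v ∈ C := h ▸ Subgroup.mem_top v
    exact hv x
  apply frattini_nongenerating
  rw [eq_top_iff]
  intro v _
  -- `Q` acts on the coset of `v`, whose size is a power of `p`. A `q`-group has a fixed point
  -- there, so the fixed subgroup `C` meets every coset of the Frattini subgroup.
  let α := {w : P // v⁻¹ * w ∈ frattini P}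
  let _ : MulAction Q α :=
    { smul := fun x w => ⟨f x w.1, by
        have h := Subgroup.mul_mem _ w.2 (hf x w.1)
        rwa [mul_assoc, mul_inv_cancel_left] at h⟩
      one_smul := fun w => Subtype.ext (by
        change f 1 w.1 = w.1
        rw [map_one]; rfl)
      mul_smul := fun a b w => Subtype.ext (by
        change f (a * b) w.1 = f a (f b w.1)
        rw [map_mul]; rfl) }
  have hcard : Nat.card α = Nat.card (frattini P) :=
    Nat.card_congr
      { toFun := fun w => ⟨v⁻¹ * w.1, w.2⟩
        invFun := fun u => ⟨v * u.1, by simp⟩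
        left_inv := fun w => by simp
        right_inv := fun u => by simp }
  have hndvd : ¬ q ∣ Nat.card α := by
    obtain ⟨n, hn⟩ := IsPGroup.iff_card.1 (hP.to_subgroup (frattini P))
    rw [hcard, hn]
    intro h
    exact hpq ((Nat.prime_dvd_prime_iff_eq hq.out hp.out).1 (hq.out.dvd_of_dvd_pow h))
  obtain ⟨w, hw⟩ := hQ.nonempty_fixed_point_of_prime_not_dvd_card α hndvd
  have hwC : w.1 ∈ C := fun x => congrArg Subtype.val (hw x)
  have h2 : v = w.1 * (v⁻¹ * w.1)⁻¹ := by group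
  rw [h2]
  exact Subgroup.mul_mem_sup hwC (Subgroup.inv_mem _ w.2)

/-- Since μ - 1 is invertible modulo `p`, `v` is a power of `v ^ (μ - 1)`. -/
theorem IsVectorSpaceOver.mem_of_pow_mul_inv_mem {p : ℕ} [Fact p.Prime] {V : Type*} [Group V]
    (hV : IsVectorSpaceOver p V) {μ : ZMod p} (hμ : μ ≠ 1) {W : Subgroup V} {v : V}
    (h : v ^ μ.val * v⁻¹ ∈ W) : v ∈ W := by
  by_cases hv : v = 1
  · exact hv ▸ W.one_mem
  obtain ⟨m, hm⟩ := ZMod.intCast_surjective ((μ - 1)⁻¹)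
  have h1 : v ^ (((μ.val : ℤ) - 1) * m - 1) = 1 := by
    rw [hV.zpow_eq_one_iff hv]
    push_cast
    rw [hm, ZMod.natCast_zmod_val, mul_inv_cancel₀ (sub_ne_zero.2 hμ), sub_self]
  rw [zpow_sub, mul_inv_eq_one, zpow_one, zpow_mul, zpow_sub, zpow_one, zpow_natCast] at h1
  rw [← h1]
  exact W.zpow_mem h m

end Coprime

/-! ### Subgroups generated by members of a Sylow family -/

namespace SylowFamily

variable {G : Type*} [Group G]

/-- The subgroup generated by the `S_p` with `p ∈ s`. -/
def hall (S : SylowFamily G) (s : Set (PrimeDivisor G)) : Subgroup G := ⨆ p : s, S.grp p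

theorem grp_le_hall (S : SylowFamily G) {s : Set (PrimeDivisor G)} {p : PrimeDivisor G}
    (hp : p ∈ s) : S.grp p ≤ S.hall s :=
  le_iSup (fun p : s => S.grp p) ⟨p, hp⟩

theorem hall_le (S : SylowFamily G) {s : Set (PrimeDivisor G)} {K : Subgroup G}
    (h : ∀ p ∈ s, S.grp p ≤ K) : S.hall s ≤ K :=
  iSup_le fun p => h p p.2

theorem hall_mono (S : SylowFamily G) {s t : Set (PrimeDivisor G)} (h : s ⊆ t) :
    S.hall s ≤ S.hall t :=
  S.hall_le fun _ hp => S.grp_le_hall (h hp)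

theorem hall_insert (S : SylowFamily G) (s : Set (PrimeDivisor G)) (p : PrimeDivisor G) :
    S.hall (insert p s) = S.hall s ⊔ S.grp p := by
  apply le_antisymm
  · apply S.hall_le
    rintro q (rfl | hq)
    · exact le_sup_right
    · exact (S.grp_le_hall hq).trans le_sup_left
  · exact sup_le (S.hall_mono (Set.subset_insert _ _)) (S.grp_le_hall (Set.mem_insert _ _))

theorem hall_union (S : SylowFamily G) (s t : Set (PrimeDivisor G)) :
    S.hall (s ∪ t) = S.hall s ⊔ S.hall t := by
  apply le_antisymm
  · apply S.hall_le
    rintro q (hq | hq)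
    · exact (S.grp_le_hall hq).trans le_sup_left
    · exact (S.grp_le_hall hq).trans le_sup_right
  · exact sup_le (S.hall_mono Set.subset_union_left) (S.hall_mono Set.subset_union_right)

theorem hall_Ici (S : SylowFamily G) (p : PrimeDivisor G) :
    S.hall (Set.Ici p) = S.hall (Set.Ioi p) ⊔ S.grp p := by
  rw [← Set.Ioi_insert, hall_insert]

theorem grp_le_T (S : SylowFamily G) {p q : PrimeDivisor G} (h : q < p) : S.grp q ≤ S.T p :=
  S.grp_le_hall (s := Set.Iio p) h

theorem le_normalizer_hall (S : SylowFamily G) {s : Set (PrimeDivisor G)} {H : Subgroup G}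
    (h : ∀ p ∈ s, H ≤ Subgroup.normalizer (S.grp p : Set G)) :
    H ≤ Subgroup.normalizer (S.hall s : Set G) :=
  le_trans (le_iInf fun p : s => h p p.2) (Subgroup.iInf_normalizer_le_normalizer_iSup _)

theorem isPGroup_grp (S : SylowFamily G) (p : PrimeDivisor G) : IsPGroup p (S.grp p) :=
  (S.sylow p).isPGroup'

theorem act_apply (S : SylowFamily G) (p : PrimeDivisor G) (x : S.T p) (v : S.grp p) :
    (S.act p x v : G) = x * v * (x : G)⁻¹ := rfl

variable [Finite G]

instance : Finite (PrimeDivisor G) :=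
  Set.Finite.subset (Nat.primeFactors (Nat.card G)).finite_toSet fun _ hp =>
    Nat.mem_primeFactors.2 ⟨hp.1, hp.2, Nat.card_pos.ne'⟩

theorem card_grp (S : SylowFamily G) (p : PrimeDivisor G) :
    ∃ n, Nat.card (S.grp p) = (p : ℕ) ^ n :=
  IsPGroup.iff_card.1 (S.sylow p).isPGroup'

theorem exists_mem_of_prime_dvd_card_hall (S : SylowFamily G) (s : Set (PrimeDivisor G)) {r : ℕ}
    (hr : r.Prime) (h : r ∣ Nat.card (S.hall s)) : ∃ p ∈ s, (p : ℕ) = r := by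
  have key : ∀ t : Finset (PrimeDivisor G),
      r ∣ Nat.card (S.hall (t : Set (PrimeDivisor G))) → ∃ p ∈ t, (p : ℕ) = r := by
    intro t
    -- Adding primes in increasing order, each new Sylow subgroup is normalized by what has been
    -- generated so far, so the order divides a product.
    induction t using Finset.induction_on_max with
    | empty =>
      intro h
      have h0 : S.hall (((∅ : Finset (PrimeDivisor G)) : Set (PrimeDivisor G))) = ⊥ :=
        le_bot_iff.1 (S.hall_le fun p hp => by simp at hp)
      rw [h0, Subgroup.card_bot] at h
      exact absurd (Nat.dvd_one.1 h) hr.ne_one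
    | insert a t ha ih =>
      intro h
      rw [Finset.coe_insert, hall_insert] at h
      have hn : S.hall (t : Set (PrimeDivisor G)) ≤ Subgroup.normalizer (S.grp a : Set G) :=
        S.hall_le fun q hq => S.normalizes a q (ha q hq)
      rcases (hr.dvd_mul).1 (h.trans (card_sup_dvd_of_le_normalizer hn)) with h | h
      · obtain ⟨p, hp, hpr⟩ := ih h
        exact ⟨p, Finset.mem_insert_of_mem hp, hpr⟩
      · obtain ⟨n, hn⟩ := S.card_grp a
        rw [hn] at h
        exact ⟨a, Finset.mem_insert_self _ _,
          ((Nat.prime_dvd_prime_iff_eq hr a.2.1).1 (hr.dvd_of_dvd_pow h)).symm⟩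
  have hs := key s.toFinite.toFinset
  simpa using hs (by simpa using h)

theorem disjoint_hall (S : SylowFamily G) {s t : Set (PrimeDivisor G)} (h : Disjoint s t) :
    Disjoint (S.hall s) (S.hall t) := by
  apply Subgroup.disjoint_of_coprime_natCard
  refine Nat.Coprime.symm (Nat.coprime_of_dvd fun r hr ht hs => ?_)
  obtain ⟨p, hp, hpr⟩ := S.exists_mem_of_prime_dvd_card_hall s hr hs
  obtain ⟨q, hq, hqr⟩ := S.exists_mem_of_prime_dvd_card_hall t hr ht
  have hpq : p = q := Subtype.ext (hpr.trans hqr.symm)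
  exact Set.disjoint_left.1 h hp (hpq ▸ hq)

theorem disjoint_grp_hall (S : SylowFamily G) {s : Set (PrimeDivisor G)} {p : PrimeDivisor G}
    (h : p ∉ s) : Disjoint (S.grp p) (S.hall s) :=
  (S.disjoint_hall (Set.disjoint_singleton_left.2 h)).mono_left
    (S.grp_le_hall (Set.mem_singleton p))

theorem not_dvd_index_of_grp_le (S : SylowFamily G) {p : PrimeDivisor G} {K : Subgroup G}
    (h : S.grp p ≤ K) : ¬ (p : ℕ) ∣ K.index := fun hd =>
  (S.sylow p).not_dvd_index (hd.trans (Subgroup.index_dvd_of_le h))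

theorem hall_univ (S : SylowFamily G) : S.hall Set.univ = ⊤ := by
  rw [← Subgroup.index_eq_one]
  by_contra hne
  obtain ⟨r, hr, hrd⟩ := Nat.exists_prime_and_dvd hne
  exact S.not_dvd_index_of_grp_le (p := ⟨r, hr, hrd.trans (Subgroup.index_dvd_card _)⟩)
    (S.grp_le_hall (Set.mem_univ _)) hrd

/-- A prime outside an upper set lies below all its members, so its Sylow subgroup normalizes each
of them. -/
theorem hall_normal (S : SylowFamily G) {s : Set (PrimeDivisor G)} (hs : IsUpperSet s) :
    (S.hall s).Normal := by
  rw [← Subgroup.normalizer_eq_top_iff, eq_top_iff, ← S.hall_univ]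
  apply S.hall_le
  intro q _
  by_cases hq : q ∈ s
  · exact (S.grp_le_hall hq).trans Subgroup.le_normalizer
  · refine S.le_normalizer_hall fun p hp => S.normalizes p q ?_
    by_contra hlt
    exact hq (hs (not_lt.1 hlt) hp)

/-- A normal subgroup containing one Sylow `p`-subgroup contains all of them. -/
theorem hall_eq_hall (R S : SylowFamily G) {s : Set (PrimeDivisor G)} (hs : IsUpperSet s) :
    R.hall s = S.hall s := by
  have key : ∀ R S : SylowFamily G, R.hall s ≤ S.hall s := by
    intro R S
    have := S.hall_normal hs
    apply R.hall_le
    intro p hp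
    obtain ⟨g, hg⟩ := MulAction.exists_smul_eq G (S.sylow p) (R.sylow p)
    rw [grp, ← hg]
    rintro _ ⟨y, hy, rfl⟩
    exact this.conj_mem y (S.grp_le_hall hp hy) g
  exact le_antisymm (key R S) (key S R)

/-! ### Intensity of the action -/

theorem exists_conj_eq_of_mem_T (hG : IsEvolving G) (S : SylowFamily G) (p : PrimeDivisor G)
    {I : Subgroup G} (hI : I ≤ S.grp p) {x : G} (hx : x ∈ S.T p) :
    ∃ s ∈ S.grp p, ∀ i ∈ I, ∃ i' ∈ I, x * i * x⁻¹ = s * i' * s⁻¹ := by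
  have hN : (S.hall (Set.Ioi p)).Normal := S.hall_normal (isUpperSet_Ioi p)
  have hA : (S.hall (Set.Ici p)).Normal := S.hall_normal (isUpperSet_Ici p)
  have hpI : IsPGroup p I := (S.sylow p).isPGroup'.to_le hI
  obtain ⟨J, hIJ, ⟨k, hk⟩, hndvd⟩ := hG.2 p p.2.1 I hpI
  have hIA : I ≤ S.hall (Set.Ici p) := hI.trans (S.grp_le_hall Set.self_mem_Ici)
  -- The index divides that of `J`, a power of `p`, but is prime to `p` because a Sylow `p`-subgroup
  -- is contained.
  have htop : S.hall (Set.Ici p) ⊔ J = ⊤ := by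
    rw [← Subgroup.index_eq_one]
    have h1 := Subgroup.index_dvd_of_le (le_sup_right : J ≤ S.hall (Set.Ici p) ⊔ J)
    rw [hk, Nat.dvd_prime_pow p.2.1] at h1
    obtain ⟨m, -, hm⟩ := h1
    have h2 := S.not_dvd_index_of_grp_le (p := p)
      ((S.grp_le_hall Set.self_mem_Ici).trans (le_sup_left : _ ≤ S.hall (Set.Ici p) ⊔ J))
    rw [hm] at h2 ⊢
    rcases Nat.eq_zero_or_pos m with rfl | hm0
    · exact pow_zero _
    · exact absurd (dvd_pow_self _ hm0.ne') h2
  obtain ⟨a, ha, j, hj, haj⟩ := Subgroup.mem_sup_of_normal_left.1 (htop ▸ Subgroup.mem_top x)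
  rw [hall_Ici] at ha
  obtain ⟨n, hn, s, hs, hns⟩ := Subgroup.mem_sup_of_normal_left.1 ha
  let f := QuotientGroup.mk' (S.hall (Set.Ioi p))
  -- The relative index is a power of `p`, as the larger image lies in that of `S_p`, and it divides
  -- `|J : I|`, which is prime to `p`.
  have hle : (S.hall (Set.Ici p) ⊓ J).map f ≤ I.map f := by
    rw [← Subgroup.relIndex_eq_one]
    have h1 : (I.map f).relIndex ((S.hall (Set.Ici p) ⊓ J).map f) ∣ I.relIndex J := by
      rw [← Subgroup.relIndex_mul_relIndex I (S.hall (Set.Ici p) ⊓ J) J (le_inf hIA hIJ)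
        inf_le_right, ← Subgroup.relIndex_comap]
      exact (Subgroup.relIndex_dvd_of_le_left _ (Subgroup.le_comap_map f I)).mul_right _
    have h2 : (S.hall (Set.Ici p) ⊓ J).map f ≤ (S.grp p).map f := by
      refine (Subgroup.map_mono inf_le_left).trans ?_
      rw [hall_Ici, Subgroup.map_sup]
      refine sup_le ?_ le_rfl
      rintro _ ⟨y, hy, rfl⟩
      have hy1 : f y = 1 := (QuotientGroup.eq_one_iff y).2 hy
      rw [hy1]
      exact Subgroup.one_mem _
    have h3 : IsPGroup p ((S.hall (Set.Ici p) ⊓ J).map f) :=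
      ((S.sylow p).isPGroup'.map f).to_le h2
    obtain ⟨m, hm⟩ := IsPGroup.iff_card.1 h3
    have h4 := Subgroup.relIndex_dvd_card (I.map f) ((S.hall (Set.Ici p) ⊓ J).map f)
    rw [hm, Nat.dvd_prime_pow p.2.1] at h4
    obtain ⟨l, -, hl⟩ := h4
    rw [hl] at h1 ⊢
    rcases Nat.eq_zero_or_pos l with rfl | hl0
    · exact pow_zero _
    · exact absurd ((dvd_pow_self _ hl0.ne').trans h1) hndvd
  refine ⟨s, hs, fun i hi => ?_⟩
  have hmem : f (j * i * j⁻¹) ∈ I.map f :=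
    hle ⟨_, ⟨hA.conj_mem i (hIA hi) j, J.mul_mem (J.mul_mem hj (hIJ hi)) (J.inv_mem hj)⟩, rfl⟩
  obtain ⟨i', hi', hfi⟩ := hmem
  refine ⟨i', hi', ?_⟩
  have hfn : f n = 1 := (QuotientGroup.eq_one_iff n).2 hn
  have hfx : f x = f s * f j := by rw [← haj, ← hns, map_mul, map_mul, hfn, one_mul]
  have heq : f (x * i * x⁻¹) = f (s * i' * s⁻¹) := by
    simp only [map_mul, map_inv] at hfi ⊢
    rw [hfi, hfx]
    group
  have h1 : (x * i * x⁻¹)⁻¹ * (s * i' * s⁻¹) ∈ S.hall (Set.Ioi p) := QuotientGroup.eq.1 heq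
  have hxi : x * i * x⁻¹ ∈ S.grp p :=
    (Subgroup.mem_normalizer_iff.1 (S.T_le_normalizer p hx) i).1 (hI hi)
  have hsi : s * i' * s⁻¹ ∈ S.grp p :=
    (S.grp p).mul_mem ((S.grp p).mul_mem hs (hI hi')) ((S.grp p).inv_mem hs)
  -- Both elements lie in `S_p`, which meets the kernel of `f` trivially, so equality modulo that
  -- kernel is equality.
  have h2 := Subgroup.disjoint_def.1 (S.disjoint_grp_hall (Set.self_notMem_Ioi (a := p)))
    ((S.grp p).mul_mem ((S.grp p).inv_mem hxi) hsi) h1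
  exact inv_mul_eq_one.1 h2

theorem actsIntensely (hG : IsEvolving G) (S : SylowFamily G) : S.ActsIntensely := by
  intro p x H
  obtain ⟨s, hs, h⟩ := S.exists_conj_eq_of_mem_T hG p
    (Subgroup.map_subtype_le H) x.2
  refine ⟨⟨s, hs⟩, ?_⟩
  -- One inclusion suffices: both images have the order of `H`.
  apply Subgroup.eq_of_le_of_card_ge
  · rintro _ ⟨v, hv, rfl⟩
    obtain ⟨_, ⟨w, hw, rfl⟩, hvw⟩ := h v ⟨v, hv, rfl⟩
    exact ⟨w, hw, Subtype.ext hvw.symm⟩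
  · exact (Subgroup.card_map_of_injective (MulAut.conj (⟨s, hs⟩ : S.grp p)).injective).trans
      (Subgroup.card_map_of_injective (S.act p x).injective).symm |>.le

/-! ### Edges as failure to commute -/

theorem mk_act (S : SylowFamily G) (hS : S.ActsIntensely) (p : PrimeDivisor G) (x : S.T p)
    (v : S.grp p) : (QuotientGroup.mk (S.act p x v) : S.grp p ⧸ frattini (S.grp p)) =
      (QuotientGroup.mk v) ^ ((S.lam hS p x : (ZMod p)ˣ) : ZMod p).val :=
  intScalar_spec (S.isVectorSpaceOver p)
    (intQuotient (frattini (S.grp p)) ⟨S.act p x, hS p x⟩) (QuotientGroup.mk v)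

theorem commute_of_lam_eq_one (S : SylowFamily G) (hS : S.ActsIntensely) {p q : PrimeDivisor G}
    (hpq : q < p) (h : ∀ x (hx : x ∈ S.grp q), S.lam hS p ⟨x, S.grp_le_T hpq hx⟩ = 1)
    {x y : G} (hx : x ∈ S.grp q) (hy : y ∈ S.grp p) : x * y = y * x := by
  have hne : (q : ℕ) ≠ p := fun h => hpq.ne (Subtype.ext h)
  have key := eq_of_trivial_mod_frattini hne (S.isPGroup_grp p) (S.isPGroup_grp q)
    ((S.act p).comp (Subgroup.inclusion (S.grp_le_T hpq))) (by
      intro x v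
      refine QuotientGroup.eq.1 ((S.mk_act hS p _ v).trans ?_).symm
      have hx1 : S.lam hS p (Subgroup.inclusion (S.grp_le_T hpq) x) = 1 := h x.1 x.2
      rw [hx1, Units.val_one, ZMod.val_one, pow_one])
  exact mul_inv_eq_iff_eq_mul.1 (congrArg Subtype.val (key ⟨x, hx⟩ ⟨y, hy⟩))

/-- Eliminates λ_p: scalar 1 means trivial action modulo Frattini, hence trivial action, by
coprimality. -/
theorem graph_adj_iff (S : SylowFamily G) (hS : S.ActsIntensely) {p q : PrimeDivisor G} :
    (S.graph hS).Adj q p ↔ q < p ∧ ¬ ∀ x ∈ S.grp q, ∀ y ∈ S.grp p, x * y = y * x := by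
  refine and_congr_right fun hpq => not_congr ⟨fun h x hx y hy => ?_, fun h => ?_⟩
  · refine S.commute_of_lam_eq_one hS hpq (fun x hx => ?_) hx hy
    rw [← Subgroup.mem_bot, ← h]
    exact ⟨_, hx, rfl⟩
  · rw [eq_bot_iff]
    rintro _ ⟨x, hx, rfl⟩
    rw [Subgroup.mem_bot, Units.ext_iff]
    apply (S.isVectorSpaceOver p).scalar_unique
    intro v
    obtain ⟨v, rfl⟩ := QuotientGroup.mk_surjective v
    rw [← S.mk_act hS, Units.val_one, ZMod.val_one, pow_one]
    congr 1
    apply Subtype.ext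
    rw [act_apply, h x hx v v.2, mul_inv_cancel_right]

/-! ### Independence of the Sylow family -/

/-- The right side involves, besides `S_q`, only normal subgroups independent of the family, so it
survives conjugating `S_q`. This is what allows two families to be compared. -/
theorem commute_grp_iff (S : SylowFamily G) {p q : PrimeDivisor G} (hpq : q < p) :
    (∀ x ∈ S.grp q, ∀ y ∈ S.grp p, x * y = y * x) ↔
      ∀ x ∈ S.grp q, ∀ a ∈ S.hall (Set.Ici p), x * a * x⁻¹ * a⁻¹ ∈ S.hall (Set.Ioi p) := by
  have hN : (S.hall (Set.Ioi p)).Normal := S.hall_normal (isUpperSet_Ioi p)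
  constructor
  · intro h x hx a ha
    rw [hall_Ici] at ha
    obtain ⟨s, hs, n, hn, rfl⟩ := Subgroup.mem_sup_of_normal_right.1 ((sup_comm (S.hall (Set.Ioi p)) (S.grp p)) ▸ ha)
    have h1 : x * (s * n) * x⁻¹ * (s * n)⁻¹ = s * (x * n * x⁻¹ * n⁻¹) * s⁻¹ := by
      rw [← mul_assoc x, h x hx s hs]
      group
    rw [h1]
    exact hN.conj_mem _ (mul_mem (hN.conj_mem n hn x) (inv_mem hn)) s
  · intro h x hx y hy
    have h1 : x * y * x⁻¹ ∈ S.grp p :=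
      (Subgroup.mem_normalizer_iff.1 (S.normalizes p q hpq hx) y).1 hy
    have h2 := Subgroup.disjoint_def.1 (S.disjoint_grp_hall (Set.self_notMem_Ioi (a := p)))
      (mul_mem h1 (inv_mem hy)) (h x hx y (S.grp_le_hall Set.self_mem_Ici hy))
    exact mul_inv_eq_iff_eq_mul.1 (mul_inv_eq_one.1 h2)

theorem graph_le_graph (R S : SylowFamily G) (hR : R.ActsIntensely) (hS : S.ActsIntensely)
    {p q : PrimeDivisor G} (h : (R.graph hR).Adj q p) : (S.graph hS).Adj q p := by
  rw [graph_adj_iff] at h ⊢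
  refine ⟨h.1, fun hc => h.2 ?_⟩
  rw [commute_grp_iff _ h.1] at hc ⊢
  rw [R.hall_eq_hall S (isUpperSet_Ici p), R.hall_eq_hall S (isUpperSet_Ioi p)]
  obtain ⟨g, hg⟩ := MulAction.exists_smul_eq G (S.sylow q) (R.sylow q)
  rw [grp, ← hg]
  rintro _ ⟨x, hx, rfl⟩ a ha
  have hN : (S.hall (Set.Ioi p)).Normal := S.hall_normal (isUpperSet_Ioi p)
  have hA : (S.hall (Set.Ici p)).Normal := S.hall_normal (isUpperSet_Ici p)
  have h1 := hN.conj_mem _ (hc x hx (g⁻¹ * a * g⁻¹⁻¹) (hA.conj_mem a ha g⁻¹)) g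
  have h2 : g * (x * (g⁻¹ * a * g⁻¹⁻¹) * x⁻¹ * (g⁻¹ * a * g⁻¹⁻¹)⁻¹) * g⁻¹ =
      (g * x * g⁻¹) * a * (g * x * g⁻¹)⁻¹ * a⁻¹ := by group
  rwa [h2] at h1

theorem graph_eq_graph (R S : SylowFamily G) (hR : R.ActsIntensely) (hS : S.ActsIntensely) :
    R.graph hR = S.graph hS := by
  ext q p
  exact ⟨R.graph_le_graph S hR hS, S.graph_le_graph R hS hR⟩

/-! ### No consecutive edges -/

theorem not_adj_of_adj (S : SylowFamily G) (hS : S.ActsIntensely) {p q r : PrimeDivisor G}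
    (hqp : (S.graph hS).Adj q p) : ¬ (S.graph hS).Adj p r := by
  intro hpr
  obtain ⟨hlt, hnc⟩ := (S.graph_adj_iff hS).1 hpr
  obtain ⟨x, hx, hx1⟩ : ∃ x : S.T p, (x : G) ∈ S.grp q ∧ S.lam hS p x ≠ 1 := by
    by_contra! hc
    refine hqp.2 (eq_bot_iff.2 ?_)
    rintro _ ⟨x, hx, rfl⟩
    exact hc x hx
  let i : S.grp p →* S.T r := Subgroup.inclusion (S.grp_le_T hlt)
  have hC : ((S.lam hS r).comp i).ker = ⊤ := by
    apply frattini_nongenerating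
    -- It is enough that the kernel maps onto `S_p/Φ(S_p)`.
    rw [← QuotientGroup.ker_mk' (frattini (S.grp p)), ← Subgroup.comap_map_eq, eq_top_iff]
    intro y _
    rw [Subgroup.mem_comap]
    refine (S.isVectorSpaceOver p).mem_of_pow_mul_inv_mem
      (μ := ((S.lam hS p x : (ZMod p)ˣ) : ZMod p)) (fun h => hx1 (Units.ext h)) ?_
    -- This is the commutator of `x` and `y`: killed by the abelian-valued λ_r, and equal to `y ^ μ
    -- * y⁻¹` modulo Frattini.
    refine ⟨S.act p x y * y⁻¹, ?_, ?_⟩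
    · let x' : S.T r := ⟨x, S.grp_le_T (hqp.1.trans hlt) hx⟩
      have h1 : i (S.act p x y * y⁻¹) = x' * i y * x'⁻¹ * (i y)⁻¹ := rfl
      change S.lam hS r (i (S.act p x y * y⁻¹)) = 1
      rw [h1]
      simp only [map_mul, map_inv]
      rw [mul_comm (S.lam hS r x'), mul_inv_cancel_right, mul_inv_cancel]
    · rw [map_mul, map_inv]
      exact congrArg (· * _) (S.mk_act hS p x y)
  refine hnc fun y hy z hz => S.commute_of_lam_eq_one hS hlt (fun w hw => ?_) hy hz
  have hmem : (⟨w, hw⟩ : S.grp p) ∈ ((S.lam hS r).comp i).ker := hC ▸ Subgroup.mem_top _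
  exact hmem

/-! ### The decomposition -/

theorem commute_of_not_adj (S : SylowFamily G) (hS : S.ActsIntensely) {p q : PrimeDivisor G}
    (hpq : p ≠ q) (h1 : ¬ (S.graph hS).Adj p q) (h2 : ¬ (S.graph hS).Adj q p) {x y : G}
    (hx : x ∈ S.grp p) (hy : y ∈ S.grp q) : x * y = y * x := by
  rw [graph_adj_iff, not_and, not_not] at h1 h2
  rcases hpq.lt_or_gt with h | h
  · exact h1 h x hx y hy
  · exact (h2 h y hy x hx).symm

theorem isInternalProd_hall (S : SylowFamily G) (hS : S.ActsIntensely)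
    {s : Set (PrimeDivisor G)} (h : ∀ p ∈ s, ∀ q ∈ s, ¬ (S.graph hS).Adj p q) :
    IsInternalProd (fun p : s => S.grp p) (S.hall s) := by
  refine ⟨fun p q hpq x hx y hy => S.commute_of_not_adj hS (fun h => hpq (Subtype.ext h))
    (h p p.2 q q.2) (h q q.2 p p.2) hx hy, fun p => ?_, rfl⟩
  refine (S.disjoint_grp_hall (s := {(p : PrimeDivisor G)}ᶜ) fun h => h rfl).mono_right ?_
  exact iSup₂_le fun q hq => S.grp_le_hall fun h => hq (Subtype.ext h)

/-- If `q < p`, the Sylow family gives normalization. If `p < q`, an edge could only go from `p` to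
`q`; there is none, so the two Sylow subgroups commute. -/
theorem hall_le_normalizer_hall (S : SylowFamily G) (hS : S.ActsIntensely)
    {s t : Set (PrimeDivisor G)} (h : ∀ p ∈ s, ∀ q ∈ t, p ≠ q ∧ ¬ (S.graph hS).Adj p q) :
    S.hall t ≤ Subgroup.normalizer (S.hall s : Set G) := by
  refine S.hall_le fun q hq => S.le_normalizer_hall fun p hp => ?_
  obtain ⟨hne, hadj⟩ := h p hp q hq
  rcases hne.lt_or_gt with hlt | hlt
  · rw [Subgroup.le_normalizer_iff]
    intro x hx y hy
    rw [← S.commute_of_not_adj hS hne hadj (fun h => h.1.not_gt hlt) hy hx, mul_inv_cancel_right]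
    exact hy
  · exact S.normalizes p q hlt

theorem commute_hall (S : SylowFamily G) (hS : S.ActsIntensely) {s t : Set (PrimeDivisor G)}
    (h : ∀ p ∈ s, ∀ q ∈ t, p ≠ q ∧ ¬ (S.graph hS).Adj p q ∧ ¬ (S.graph hS).Adj q p)
    {x y : G} (hx : x ∈ S.hall s) (hy : y ∈ S.hall t) : x * y = y * x := by
  have h1 : S.hall s ≤ Subgroup.centralizer (S.hall t : Set G) := by
    refine S.hall_le fun p hp => ?_
    rw [Subgroup.le_centralizer_iff]
    refine S.hall_le fun q hq z hz => Subgroup.mem_centralizer_iff.2 fun w hw => ?_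
    obtain ⟨hne, h1, h2⟩ := h p hp q hq
    exact S.commute_of_not_adj hS hne h1 h2 hw hz
  exact (Subgroup.mem_centralizer_iff.1 (h1 hx) y hy).symm

end SylowFamily

end Evolving

theorem mainTheorem4 {G : Type*} [Group G] [Finite G] (hG : Evolving.IsEvolving G)
    (S : Evolving.SylowFamily G) :
    ∃ hS : S.ActsIntensely,
      (∀ (R : Evolving.SylowFamily G) (hR : R.ActsIntensely), R.graph hR = S.graph hS) ∧
      Disjoint (Evolving.sources (S.graph hS)) (Evolving.targets (S.graph hS)) ∧
      ∃ N T Z K : Subgroup G,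
        Evolving.IsInternalProd (fun p : Evolving.targets (S.graph hS) => S.grp p) N ∧
        Evolving.IsInternalProd (fun p : Evolving.sources (S.graph hS) => S.grp p) T ∧
        Evolving.IsInternalProd (fun p : Evolving.isolated (S.graph hS) => S.grp p) Z ∧
        Evolving.IsInternalSemidirect N T K ∧
        Evolving.IsInternalDirect K Z ⊤ := by
  have hS := S.actsIntensely hG
  have hst : Disjoint (Evolving.sources (S.graph hS)) (Evolving.targets (S.graph hS)) :=
    Set.disjoint_left.2 fun _ ⟨_, h1⟩ ⟨_, h2⟩ => S.not_adj_of_adj hS h2 h1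
  have hts : ∀ p ∈ Evolving.targets (S.graph hS), ∀ q, ¬ (S.graph hS).Adj p q :=
    fun p hp q h => Set.disjoint_left.1 hst ⟨q, h⟩ hp
  have hu : Evolving.targets (S.graph hS) ∪ Evolving.sources (S.graph hS) =
      (Evolving.isolated (S.graph hS))ᶜ := by
    rw [Evolving.isolated, compl_compl, Set.union_comm]
  -- None of the three vertex sets contains an edge: targets emit none, sources receive none,
  -- isolated vertices do neither.
  refine ⟨hS, fun R hR => R.graph_eq_graph S hR hS, hst,
    S.hall (Evolving.targets (S.graph hS)), S.hall (Evolving.sources (S.graph hS)),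
    S.hall (Evolving.isolated (S.graph hS)), S.hall (Evolving.isolated (S.graph hS))ᶜ,
    S.isInternalProd_hall hS fun p hp q _ => hts p hp q,
    S.isInternalProd_hall hS fun p _ q hq h => Set.disjoint_left.1 hst hq ⟨p, h⟩,
    S.isInternalProd_hall hS fun p hp q _ h => hp (Or.inl ⟨q, h⟩),
    ⟨S.hall_le_normalizer_hall hS fun p hp q hq => ⟨?_, hts p hp q⟩,
      (S.disjoint_hall hst.symm).eq_bot, ?_⟩,
    ⟨fun x hx y hy => S.commute_hall hS (fun p hp q hq => ⟨?_, ?_, ?_⟩) hx hy,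
      (S.disjoint_hall disjoint_compl_left).eq_bot, ?_⟩⟩
  · rintro rfl
    exact Set.disjoint_left.1 hst hq hp
  · rw [← S.hall_union, hu]
  · rintro rfl
    exact hp hq
  · exact fun h => hq (Or.inr ⟨p, h⟩)
  · exact fun h => hq (Or.inl ⟨p, h⟩)
  · rw [← S.hall_union, Set.compl_union_self, S.hall_univ]
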